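/- Setting. There are agents $\mathcal K=\{1,\dots,K\}$, $K\ge 1$, and goods $\mathcal N=\{1,\dots,N\}$; each agent $j$ has a family $\mathcal A_j\subseteq 2^{\mathcal N}$ of feasible bundles. An allocation is a map $\phi$ with $\phi(j)\in\mathcal A_j$ for all $j$ and $\phi(i)\cap\phi(j)=\emptyset$ for $i\neq j$; $\mathcal M$ is the set of allocations. Every agent $j$ has a reward function $r^j(x;S)$ of a quality vector $x\in\mathbb R^N$ and a bundle $S\in\bigcup_k\mathcal A_k$. For $x,y\in\mathbb R^N$ put $$ev_{i\to j}(x,y,\phi)=\max\{r^i(x;\phi(j))-r^i(y;\phi(i)),\,0\},\qquad ev(x,y,\phi)=\max_{i,j\in\mathcal K}ev_{i\to j}(x,y,\phi),$$ and $ev_{i\to j}(\mu,\phi)=ev_{i\to j}(\mu,\mu,\phi)$, $ev(\mu,\phi)=ev(\mu,\mu,\phi)$, where $\mu\in\mathbb R^N$ is the unknown true quality vector. Let $\mathcal E^*$ be the set of allocations that minimize $ev(\mu,\cdot)$ over $\mathcal M$, assumed non-empty (i.e. $\mathcal M\ne\emptyset$). Feedback. If good $i$ is observed in round $t$, the value $X_i(t)=\mu_i+\epsilon_i(t)$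 is revealed. The noise vectors $(\epsilon_i(t))_{i\in\mathcal N}$ of different rounds are independent and each $\epsilon_i(t)$ is centered and $\sigma^2$-subgaussian, $\sigma>0$. Algorithm (Envy-combinatorial ULCB, with parameter $\alpha>2$). In round $t=1,\dots,N$ good $t$ is observed (the allocation $\phi_t\in\mathcal M$ in force in these rounds is arbitrary). In round $t>N$ let $T_i$ be the number of earlier rounds in which good $i$ was observed, $\hat\mu_i$ the average of the values observed in them, and $$\bar\nu_i(t)=\hat\mu_i+\sqrt{\tfrac{2\sigma^2\log t^{\alpha}}{T_i}},\qquad \underline\nu_i(t)=\hat\mu_i-\sqrt{\tfrac{2\sigma^2\log t^{\alpha}}{T_i}} .$$ The algorithm chooses an allocation $\phi_t\in\arg\min_{\phi\in\mathcal M}ev(\underline\nu(t),\bar\nu(t),\phi)$ and then a pair $(i_t,j_t)\in\arg\max_{i,j\in\mathcal K}ev_{i\to j}(\bar\nu(t),\underline\nu(t),\phi_t)$ (by oracles that break ties by any fixed measurable rules), and it observes the goods in $\phi_t(i_t)\cup\phi_t(j_t)$. For $\phi^*\in\mathcal E^*$ its regret is $$R_T=\mathbb E\Big[\sum_{t=1}^T\big(ev(\mu,\phi_t)-ev(\mu,\phi^*)\big)\Big].$$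 Assumptions. (Lipschitz and monotone rewards) There is $c>0$ such that for every agent $j$, every $S\in\bigcup_k\mathcal A_k$ and all $x,y\in\mathbb R^N$: $|r^j(x;S)-r^j(y;S)|\le c\sum_{i\in S}|x_i-y_i|$, and $r^j(x;S)\le r^j(y;S)$ whenever $x_i\le y_i$ for all $i\in S$. (Envy gap) There are $\Delta_{e,\min},\Delta_{e,\max}>0$ such that $ev(\mu,\phi_1)-ev(\mu,\phi_2)\ge\Delta_{e,\min}$ for all $\phi_1\in\mathcal M\setminus\mathcal E^*$, $\phi_2\in\mathcal E^*$, and $|ev_{i\to j}(\mu,\phi_1)-ev_{i'\to j'}(\mu,\phi_2)|\le\Delta_{e,\max}$ for all $\phi_1,\phi_2\in\mathcal M$ and all pairs $(i,j)\ne(i',j')$ in $\mathcal K\times\mathcal K$. Theorem. Under these assumptions $$R_T=O\!\left(\frac{N^3\log T}{\Delta_{e,\min}^2}\right).$$ That is, there is a constant $C>0$ that depends only on $\alpha,\sigma,c,\Delta_{e,\max}$ such that $R_T\le C\,N^3\log T/\Delta_{e,\min}^2$ for all $T>N$ and all instances as above. -/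

import Mathlib

open MeasureTheory ProbabilityTheory

namespace EnvyBandit

/-- An assignment of a bundle of goods (a set of goods) to every agent;
agents are `Fin K`, goods are `Fin N`. -/
abbrev Assignment (K N : ℕ) : Type := Fin K → Finset (Fin N)

/-- Reward functions: `r j x S` is the reward of agent `j` for the bundle `S` when the vector of
qualities of the goods is `x`. -/
abbrev Reward (K N : ℕ) : Type := Fin K → (Fin N → ℝ) → Finset (Fin N) → ℝ

/-- The set `𝓜` of allocations: agent `j` gets a feasible bundle (an element of `A j`), and no good
is given to two agents. -/
def allocations {K N : ℕ} (A : Fin K → Set (Finset (Fin N))) : Set (Assignment K N) :=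
  {φ | (∀ j, φ j ∈ A j) ∧ ∀ i j, i ≠ j → Disjoint (φ i) (φ j)}

/-- Envy of agent `i` towards agent `j`, when the bundle of `j` is evaluated with the qualities `x`
and the own bundle of `i` with the qualities `y`. The true envy is obtained for `x = y = μ`, the
upper estimate for `x = UCB, y = LCB`, the lower estimate for `x = LCB, y = UCB`. -/
noncomputable def pairEnvy {K N : ℕ} (r : Reward K N) (x y : Fin N → ℝ) (φ : Assignment K N)
    (i j : Fin K) : ℝ :=
  max (r i x (φ j) - r i y (φ i)) 0

/-- Maximum of the pairwise envies (a maximum over finitely many pairs of agents). -/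
noncomputable def maxEnvy {K N : ℕ} (r : Reward K N) (x y : Fin N → ℝ) (φ : Assignment K N) : ℝ :=
  ⨆ p : Fin K × Fin K, pairEnvy r x y φ p.1 p.2

/-- The true envy of an allocation. -/
noncomputable def envy {K N : ℕ} (r : Reward K N) (μ : Fin N → ℝ) (φ : Assignment K N) : ℝ :=
  maxEnvy r μ μ φ

/-- The set of allocations with minimal true envy. -/
def minEnvyAllocations {K N : ℕ} (A : Fin K → Set (Finset (Fin N))) (r : Reward K N)
    (μ : Fin N → ℝ) : Set (Assignment K N) :=
  {φ | φ ∈ allocations A ∧ ∀ ψ ∈ allocations A, envy r μ φ ≤ envy r μ ψ}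

/-- Lipschitz and monotone rewards. Since envy evaluates the reward of one agent on the bundle
of another one, this is required for every agent and every bundle that is feasible for some
agent. -/
structure LipschitzMonotone {K N : ℕ} (A : Fin K → Set (Finset (Fin N))) (r : Reward K N)
    (c : ℝ) : Prop where
  lipschitz : ∀ (j : Fin K) (S : Finset (Fin N)), S ∈ (⋃ k, A k) → ∀ x y : Fin N → ℝ,
    |r j x S - r j y S| ≤ c * ∑ i ∈ S, |x i - y i|
  monotone : ∀ (j : Fin K) (S : Finset (Fin N)), S ∈ (⋃ k, A k) → ∀ x y : Fin N → ℝ,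
    (∀ i ∈ S, x i ≤ y i) → r j x S ≤ r j y S

/-- The gap assumption: optimal and non-optimal allocations differ in envy by at least `Δmin`, and
pairwise envies of different pairs differ by at most `Δmax`. -/
structure EnvyGap {K N : ℕ} (A : Fin K → Set (Finset (Fin N))) (r : Reward K N) (μ : Fin N → ℝ)
    (Δmin Δmax : ℝ) : Prop where
  gap : ∀ φ₁ ∈ allocations A, φ₁ ∉ minEnvyAllocations A r μ →
    ∀ φ₂ ∈ minEnvyAllocations A r μ, Δmin ≤ envy r μ φ₁ - envy r μ φ₂
  bound : ∀ φ₁ ∈ allocations A, ∀ φ₂ ∈ allocations A, ∀ i j i' j' : Fin K, (i, j) ≠ (i', j') →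
    |pairEnvy r μ μ φ₁ i j - pairEnvy r μ μ φ₂ i' j'| ≤ Δmax

/-- `O x y` is an allocation that minimizes the maximal envy computed with `x` and `y`
(ties broken by any measurable rule). -/
structure IsMinEnvyOracle {K N : ℕ} (A : Fin K → Set (Finset (Fin N))) (r : Reward K N)
    (O : (Fin N → ℝ) → (Fin N → ℝ) → Assignment K N) : Prop where
  mem : ∀ x y, O x y ∈ allocations A
  le : ∀ x y, ∀ φ ∈ allocations A, maxEnvy r x y (O x y) ≤ maxEnvy r x y φ
  measurable : ∀ φ, MeasurableSet {z : (Fin N → ℝ) × (Fin N → ℝ) | O z.1 z.2 = φ}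

/-- `O x y φ` is a pair of agents with the largest pairwise envy in `φ` computed with `x` and `y`
(ties broken by any measurable rule). -/
structure IsMaxPairOracle {K N : ℕ} (A : Fin K → Set (Finset (Fin N))) (r : Reward K N)
    (O : (Fin N → ℝ) → (Fin N → ℝ) → Assignment K N → Fin K × Fin K) : Prop where
  le : ∀ x y, ∀ φ ∈ allocations A, ∀ i j : Fin K,
    pairEnvy r x y φ i j ≤ pairEnvy r x y φ (O x y φ).1 (O x y φ).2
  measurable : ∀ φ p, MeasurableSet {z : (Fin N → ℝ) × (Fin N → ℝ) | O z.1 z.2 φ = p}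

/-- What the algorithm has recorded: for every good, how often it was observed, and the sum of the
observed noisy qualities. -/
structure Stats (N : ℕ) where
  count : Fin N → ℕ
  total : Fin N → ℝ

/-- Width of the confidence interval of good `i` in round `t`. -/
noncomputable def bonus {N : ℕ} (α σ : ℝ) (t : ℕ) (s : Stats N) (i : Fin N) : ℝ :=
  Real.sqrt (1 / (s.count i : ℝ) * (2 * σ ^ 2 * Real.log ((t : ℝ) ^ α)))

/-- Upper confidence bounds in round `t`, from the data `s` of the rounds before `t`. -/
noncomputable def ucb {N : ℕ} (α σ : ℝ) (t : ℕ) (s : Stats N) (i : Fin N) : ℝ :=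
  s.total i / (s.count i : ℝ) + bonus α σ t s i

/-- Lower confidence bounds in round `t`, from the data `s` of the rounds before `t`. -/
noncomputable def lcb {N : ℕ} (α σ : ℝ) (t : ℕ) (s : Stats N) (i : Fin N) : ℝ :=
  s.total i / (s.count i : ℝ) - bonus α σ t s i

/-- The inputs of the algorithm: the parameters `α` and `σ`, the two oracles, and the allocations
that are in force in the first `N` rounds, in which every good is observed once. -/
structure Algorithm (K N : ℕ) where
  α : ℝ
  σ : ℝ
  minOracle : (Fin N → ℝ) → (Fin N → ℝ) → Assignment K N
  pairOracle : (Fin N → ℝ) → (Fin N → ℝ) → Assignment K N → Fin K × Fin K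
  initial : ℕ → Assignment K N

namespace Algorithm

variable {K N : ℕ}

/-- The allocation chosen in round `t` (rounds are numbered from `1`), given the data `s` of the
rounds before `t`: after the first `N` rounds, it minimizes the lower estimate of the envy. -/
noncomputable def choose (a : Algorithm K N) (t : ℕ) (s : Stats N) : Assignment K N :=
  if t ≤ N then a.initial t else a.minOracle (lcb a.α a.σ t s) (ucb a.α a.σ t s)

/-- The goods observed in round `t`: the `t`-th good if `t ≤ N`, and later the bundles of
the two agents that maximize the upper estimate of the pairwise envy in the chosen allocation. -/
noncomputable def observed (a : Algorithm K N) (t : ℕ) (s : Stats N) : Finset (Fin N) :=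
  if t ≤ N then Finset.univ.filter fun i : Fin N => (i : ℕ) + 1 = t
  else
    let φ := a.choose t s
    let p := a.pairOracle (ucb a.α a.σ t s) (lcb a.α a.σ t s) φ
    φ p.1 ∪ φ p.2

/-- The data after `t` rounds, when `X t i` is the noisy quality of good `i` in round `t`
(which is used only if good `i` is observed in round `t`). -/
noncomputable def stats (a : Algorithm K N) (X : ℕ → Fin N → ℝ) : ℕ → Stats N
  | 0 => ⟨fun _ => 0, fun _ => 0⟩
  | t + 1 =>
    let s := a.stats X t
    let P := a.observed (t + 1) s
    ⟨fun i => s.count i + if i ∈ P then 1 else 0,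
      fun i => s.total i + if i ∈ P then X (t + 1) i else 0⟩

/-- The allocation `φ_t` of round `t ≥ 1`. -/
noncomputable def allocation (a : Algorithm K N) (X : ℕ → Fin N → ℝ) (t : ℕ) : Assignment K N :=
  a.choose t (a.stats X (t - 1))

/-- Cumulative excess envy over rounds `1, …, T`, compared to the allocation `φopt`, along one
realization `X` of the noisy qualities. -/
noncomputable def cumulativeExcess (a : Algorithm K N) (r : Reward K N) (μ : Fin N → ℝ)
    (φopt : Assignment K N) (X : ℕ → Fin N → ℝ) (T : ℕ) : ℝ :=
  ∑ t ∈ Finset.Icc 1 T, (envy r μ (a.allocation X t) - envy r μ φopt)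

end Algorithm

/-- Noise model: the noise vectors `ε t` of different rounds `t` are independent, and every
coordinate is (centered and) subgaussian with variance proxy `σ ^ 2`. -/
structure IsNoise {N : ℕ} {Ω : Type*} [MeasurableSpace Ω] (P : Measure Ω) (σ : ℝ)
    (ε : ℕ → Ω → Fin N → ℝ) : Prop where
  measurable : ∀ t, Measurable (ε t)
  indep : iIndepFun ε P
  subgaussian : ∀ t i, HasSubgaussianMGF (fun ω => ε t ω i) ⟨σ ^ 2, sq_nonneg σ⟩ P

end EnvyBandit

/-! Suppose all confidence intervals of a round contain the true qualities. By monotonicity the true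
envy of every allocation lies between its lower and upper estimates. The chosen allocation minimizes
the lower estimate and the chosen pair maximizes the upper one, so the excess envy is at most the
gap between the two estimates for that single pair. By the Lipschitz condition this is at most `2 *
c` times the total width of the intervals of the goods about to be observed
(`LipschitzMonotone.envy_sub_le`).

A suboptimal choice costs at least `Δmin`, so one of these at most `N` goods has an interval of
width at least `Δmin / (2 * c * N)`, hence at most `L ~ N ^ 2 * log T / Δmin ^ 2` earlier
observations (`exists_count_le`). Observing it raises its count, so each good is responsible for at
most `L + 1` such rounds (`card_observed_le`). Each costs at most `Δmax`; summing over the goods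
gives `N ^ 3`.

Wrong intervals contribute `O(N)`: an exponential supermartingale handles the adaptive choice of
observations (`lintegral_expDeviation_le`), and a union bound over the random count leaves a failure
probability of order `t ^ (1 - α)` per good, summable since `α > 2`. -/

namespace EnvyBandit

/-! ### Deterministic envy estimates -/

section Envy

variable {K N : ℕ} {A : Fin K → Set (Finset (Fin N))} {r : Reward K N} {c : ℝ}

lemma mem_iUnion_of_mem_allocations {φ : Assignment K N} (hφ : φ ∈ allocations A) (j : Fin K) :
    φ j ∈ ⋃ k, A k :=
  Set.mem_iUnion.2 ⟨j, hφ.1 j⟩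

lemma pairEnvy_nonneg (x y : Fin N → ℝ) (φ : Assignment K N) (i j : Fin K) :
    0 ≤ pairEnvy r x y φ i j :=
  le_max_right _ _

lemma pairEnvy_self (μ : Fin N → ℝ) (φ : Assignment K N) (i : Fin K) :
    pairEnvy r μ μ φ i i = 0 := by
  simp [pairEnvy]

lemma pairEnvy_le_maxEnvy (x y : Fin N → ℝ) (φ : Assignment K N) (i j : Fin K) :
    pairEnvy r x y φ i j ≤ maxEnvy r x y φ :=
  le_ciSup (f := fun p : Fin K × Fin K => pairEnvy r x y φ p.1 p.2)
    (Set.finite_range _).bddAbove (i, j)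

lemma maxEnvy_le (hK : 1 ≤ K) {x y : Fin N → ℝ} {φ : Assignment K N} {b : ℝ}
    (h : ∀ i j, pairEnvy r x y φ i j ≤ b) : maxEnvy r x y φ ≤ b := by
  have : NeZero K := ⟨by omega⟩
  exact ciSup_le fun p => h p.1 p.2

lemma maxEnvy_nonneg (x y : Fin N → ℝ) (φ : Assignment K N) : 0 ≤ maxEnvy r x y φ :=
  Real.iSup_nonneg fun p => pairEnvy_nonneg x y φ p.1 p.2

lemma LipschitzMonotone.maxEnvy_mono (h : LipschitzMonotone A r c) (hK : 1 ≤ K)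
    {x x' y y' : Fin N → ℝ} (hx : x ≤ x') (hy : y' ≤ y) {φ : Assignment K N}
    (hφ : φ ∈ allocations A) : maxEnvy r x y φ ≤ maxEnvy r x' y' φ := by
  refine maxEnvy_le hK fun i j => le_trans ?_ (pairEnvy_le_maxEnvy x' y' φ i j)
  refine max_le_max (sub_le_sub ?_ ?_) le_rfl
  · exact h.monotone i _ (mem_iUnion_of_mem_allocations hφ j) _ _ fun k _ => hx k
  · exact h.monotone i _ (mem_iUnion_of_mem_allocations hφ i) _ _ fun k _ => hy k

/-- Moving between the two estimates changes the rewards of both bundles; each change is bounded by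
the sum over the whole union, hence the factor 2. Truncation at 0 does not increase the difference.
-/
lemma LipschitzMonotone.pairEnvy_sub_le (h : LipschitzMonotone A r c) (hc : 0 ≤ c)
    {x y : Fin N → ℝ} (hxy : x ≤ y) {φ : Assignment K N} (hφ : φ ∈ allocations A) (i j : Fin K) :
    pairEnvy r y x φ i j - pairEnvy r x y φ i j ≤ 2 * c * ∑ k ∈ φ i ∪ φ j, (y k - x k) := by
  have hsum : ∀ S ⊆ φ i ∪ φ j, ∑ k ∈ S, |y k - x k| ≤ ∑ k ∈ φ i ∪ φ j, (y k - x k) := by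
    intro S hS
    calc ∑ k ∈ S, |y k - x k| = ∑ k ∈ S, (y k - x k) :=
          Finset.sum_congr rfl fun k _ => abs_of_nonneg (sub_nonneg.2 (hxy k))
      _ ≤ _ := Finset.sum_le_sum_of_subset_of_nonneg hS fun k _ _ => sub_nonneg.2 (hxy k)
  have h1 := (le_abs_self _).trans
    (h.lipschitz i _ (mem_iUnion_of_mem_allocations hφ j) y x)
  have h2 := (le_abs_self _).trans
    (h.lipschitz i _ (mem_iUnion_of_mem_allocations hφ i) y x)
  have h3 := mul_le_mul_of_nonneg_left (hsum _ Finset.subset_union_right) hc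
  have h4 := mul_le_mul_of_nonneg_left (hsum _ Finset.subset_union_left) hc
  have h5 : 0 ≤ c * ∑ k ∈ φ i ∪ φ j, (y k - x k) :=
    mul_nonneg hc (Finset.sum_nonneg fun k _ => sub_nonneg.2 (hxy k))
  have h6 : r i x (φ j) - r i y (φ i) ≤ pairEnvy r x y φ i j := le_max_left _ _
  have h7 := pairEnvy_nonneg (r := r) x y φ i j
  rw [sub_le_iff_le_add]
  refine max_le ?_ ?_ <;> linarith

/-- If the true qualities lie between `x` and `y`, an allocation that minimizes the lower estimate
of the envy exceeds the envy of any other one by at most the uncertainty about the bundles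
of the pair with the largest upper estimate. -/
lemma LipschitzMonotone.envy_sub_le (h : LipschitzMonotone A r c) (hK : 1 ≤ K) (hc : 0 ≤ c)
    {x y μ : Fin N → ℝ} (hx : x ≤ μ) (hy : μ ≤ y) {φ ψ : Assignment K N}
    (hφ : φ ∈ allocations A) (hψ : ψ ∈ allocations A)
    (hmin : maxEnvy r x y φ ≤ maxEnvy r x y ψ) {p : Fin K × Fin K}
    (hp : ∀ i j, pairEnvy r y x φ i j ≤ pairEnvy r y x φ p.1 p.2) :
    envy r μ φ - envy r μ ψ ≤ 2 * c * ∑ k ∈ φ p.1 ∪ φ p.2, (y k - x k) := by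
  have h1 : envy r μ φ ≤ maxEnvy r y x φ := h.maxEnvy_mono hK hy hx hφ
  have h2 : maxEnvy r y x φ ≤ pairEnvy r y x φ p.1 p.2 := maxEnvy_le hK hp
  have h3 : maxEnvy r x y ψ ≤ envy r μ ψ := h.maxEnvy_mono hK hx hy hψ
  have h4 := pairEnvy_le_maxEnvy (r := r) x y φ p.1 p.2
  have h5 := h.pairEnvy_sub_le hc (hx.trans hy) hφ p.1 p.2
  linarith

variable {μ : Fin N → ℝ} {Δmin Δmax : ℝ}

/-- The assumption only bounds differences between distinct pairs; a diagonal pair `(i, i)`, whose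
envy is 0, serves as the reference. -/
lemma EnvyGap.envy_le (h : EnvyGap A r μ Δmin Δmax) (hK : 1 ≤ K) (hΔ : 0 ≤ Δmax)
    {φ : Assignment K N} (hφ : φ ∈ allocations A) : envy r μ φ ≤ Δmax := by
  refine maxEnvy_le hK fun i j => ?_
  by_cases hij : i = j
  · rw [hij, pairEnvy_self]; exact hΔ
  · have := (le_abs_self _).trans (h.bound φ hφ φ hφ i j i i (by simpa using fun e => hij e.symm))
    rwa [pairEnvy_self, sub_zero] at this

lemma EnvyGap.envy_sub_le (h : EnvyGap A r μ Δmin Δmax) (hK : 1 ≤ K) (hΔ : 0 ≤ Δmax)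
    {φ ψ : Assignment K N} (hφ : φ ∈ allocations A) : envy r μ φ - envy r μ ψ ≤ Δmax := by
  have := h.envy_le hK hΔ hφ
  have h0 : 0 ≤ envy r μ ψ := maxEnvy_nonneg _ _ _
  linarith

end Envy

/-! ### Observation counts along one realization -/

namespace Algorithm

variable {K N : ℕ} (a : Algorithm K N) (X : ℕ → Fin N → ℝ)

lemma stats_count_succ (t : ℕ) (i : Fin N) : (a.stats X (t + 1)).count i =
    (a.stats X t).count i + if i ∈ a.observed (t + 1) (a.stats X t) then 1 else 0 := rfl

lemma stats_total_succ (t : ℕ) (i : Fin N) : (a.stats X (t + 1)).total i =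
    (a.stats X t).total i + if i ∈ a.observed (t + 1) (a.stats X t) then X (t + 1) i else 0 := rfl

lemma stats_count_mono (i : Fin N) : Monotone fun t => (a.stats X t).count i :=
  monotone_nat_of_le_succ fun t => by simp [stats_count_succ]

lemma stats_count_le (i : Fin N) (t : ℕ) : (a.stats X t).count i ≤ t := by
  induction t with
  | zero => simp [stats]
  | succ t ih => rw [stats_count_succ]; split_ifs <;> omega

lemma stats_count_pos {i : Fin N} {t : ℕ} (h : (i : ℕ) < t) : 1 ≤ (a.stats X t).count i := by
  -- Goods are indexed from 0 and rounds from 1, so the initial observation of good `i` falls in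
  -- round `i + 1`.
  have h1 : 1 ≤ (a.stats X (i + 1)).count i := by
    rw [stats_count_succ, if_pos]
    · omega
    · simp [observed, i.isLt]
  exact h1.trans (a.stats_count_mono X i h)

/-- The data after `t` rounds depend on the noisy qualities in the first `t` rounds only. -/
lemma stats_congr {X Y : ℕ → Fin N → ℝ} (t : ℕ) (h : ∀ s ≤ t, X s = Y s) :
    a.stats X t = a.stats Y t := by
  induction t with
  | zero => rfl
  | succ t ih =>
    have := ih fun s hs => h s (by omega)
    simp only [stats, this, h (t + 1) le_rfl]

/-- A good is observed at most `b + 1` times while its number of observations is at most `b`. -/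
lemma card_observed_le (i : Fin N) (b T : ℕ) :
    ((Finset.range T).filter fun t => i ∈ a.observed (t + 1) (a.stats X t) ∧
      (a.stats X t).count i ≤ b).card ≤ b + 1 := by
  -- Along the rounds that observe the good, its prior count strictly increases, so the count maps
  -- these rounds injectively into `{0, …, b}`.
  have := Finset.card_le_card_of_injOn (s := (Finset.range T).filter fun t =>
      i ∈ a.observed (t + 1) (a.stats X t) ∧ (a.stats X t).count i ≤ b)
    (t := Finset.range (b + 1)) (fun t => (a.stats X t).count i) ?_ ?_
  · simpa using this
  · intro t ht
    simp only [Finset.coe_filter, Set.mem_ofPred_eq] at ht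
    simp only [Finset.coe_range, Set.mem_Iio]
    omega
  · have key : ∀ s t, i ∈ a.observed (s + 1) (a.stats X s) → s < t →
        (a.stats X s).count i < (a.stats X t).count i := by
      intro s t hs hst
      have h1 := a.stats_count_mono X i (Nat.succ_le_of_lt hst)
      simp only [Nat.succ_eq_add_one, stats_count_succ, if_pos hs] at h1
      omega
    intro s hs t ht hst
    simp only [Finset.coe_filter, Set.mem_ofPred_eq] at hs ht
    dsimp only at hst
    rcases lt_trichotomy s t with h | h | h
    · exact absurd hst (key s t hs.2.1 h).ne
    · exact h
    · exact absurd hst (key t s ht.2.1 h).ne'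

variable {a} {A : Fin K → Set (Finset (Fin N))} {r : Reward K N} {c : ℝ}

lemma allocation_mem (hO : IsMinEnvyOracle A r a.minOracle)
    (hinit : ∀ t, a.initial t ∈ allocations A) (t : ℕ) : a.allocation X t ∈ allocations A := by
  unfold allocation choose
  split_ifs
  · exact hinit t
  · exact hO.mem _ _

lemma bonus_le {α σ : ℝ} {t T : ℕ} (hα : 0 ≤ α) (ht : 1 ≤ t) (htT : t ≤ T) (s : Stats N)
    (i : Fin N) :
    bonus α σ t s i ≤ Real.sqrt (2 * σ ^ 2 * (α * Real.log T) / (s.count i : ℝ)) := by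
  unfold bonus
  have ht' : (0 : ℝ) < t := by exact_mod_cast ht
  rw [Real.log_rpow ht', one_div_mul_eq_div]
  gcongr

/-- In a round in which all confidence intervals are correct, a suboptimal allocation is only chosen
if some observed good has been observed rarely. -/
lemma exists_count_le {μ : Fin N → ℝ} {Δmin Δmax : ℝ}
    (hLM : LipschitzMonotone A r c) (hgap : EnvyGap A r μ Δmin Δmax) (hK : 1 ≤ K) (hc : 0 < c)
    (hΔ : 0 < Δmin) (hα : 0 ≤ a.α) (hO : IsMinEnvyOracle A r a.minOracle)
    (hQ : IsMaxPairOracle A r a.pairOracle) {ψ : Assignment K N}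
    (hψ : ψ ∈ minEnvyAllocations A r μ) {t T : ℕ} (hNt : N ≤ t) (htT : t + 1 ≤ T)
    (hl : lcb a.α a.σ (t + 1) (a.stats X t) ≤ μ) (hu : μ ≤ ucb a.α a.σ (t + 1) (a.stats X t))
    (hsub : a.allocation X (t + 1) ∉ minEnvyAllocations A r μ) :
    ∃ i ∈ a.observed (t + 1) (a.stats X t), ((a.stats X t).count i : ℝ) ≤
      32 * c ^ 2 * N ^ 2 * a.σ ^ 2 * a.α * Real.log T / Δmin ^ 2 := by
  have hnot : ¬ t + 1 ≤ N := by omega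
  set s := a.stats X t with hs
  set x := lcb a.α a.σ (t + 1) s
  set y := ucb a.α a.σ (t + 1) s
  have hall : a.allocation X (t + 1) = a.minOracle x y := by
    simp [allocation, choose, hnot, x, y, s]
  rw [hall] at hsub
  have hmem := hO.mem x y
  have hobs : a.observed (t + 1) s = a.minOracle x y (a.pairOracle y x (a.minOracle x y)).1 ∪
      a.minOracle x y (a.pairOracle y x (a.minOracle x y)).2 := by
    simp [observed, choose, hnot, x, y]
  have h1 := hgap.gap _ hmem hsub _ hψ
  have h2 := hLM.envy_sub_le hK hc.le hl hu hmem hψ.1 (hO.le x y ψ hψ.1)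
    (hQ.le y x _ hmem)
  rw [← hobs] at h2
  by_contra! hcon
  set L := 32 * c ^ 2 * N ^ 2 * a.σ ^ 2 * a.α * Real.log T / Δmin ^ 2
  have hlog : 0 ≤ Real.log T := Real.log_natCast_nonneg T
  have hL : 0 ≤ L := by positivity
  -- With nothing observed the excess would be at most 0, below the gap. Nonemptiness is needed for
  -- the strict inequality between sums.
  have hN : a.observed (t + 1) s ≠ ∅ := by
    intro h
    rw [h] at h2
    simp only [Finset.sum_empty, mul_zero] at h2
    linarith
  have hlt : ∀ k ∈ a.observed (t + 1) s, y k - x k < Δmin / (2 * c * N) := by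
    intro k hk
    have hN0 : (0 : ℝ) < N := by exact_mod_cast (Nat.zero_le _).trans_lt k.isLt
    have hcount := hcon k hk
    have hcount0 : (0 : ℝ) < s.count k := hL.trans_lt hcount
    have e : y k - x k = 2 * bonus a.α a.σ (t + 1) s k := by
      simp only [x, y, lcb, ucb]; ring
    have hb := bonus_le (σ := a.σ) hα (Nat.le_add_left 1 t) htT s k
    have hb2 : Real.sqrt (2 * a.σ ^ 2 * (a.α * Real.log T) / (s.count k : ℝ)) <
        Δmin / (4 * c * N) := by
      -- `L` is the count at which the bonus bound equals `Δmin / (4 * c * N)`, half the critical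
      -- width; so `32 = 2 * 4 ^ 2`.
      rw [Real.sqrt_lt' (by positivity), div_lt_iff₀ hcount0]
      have : 2 * a.σ ^ 2 * (a.α * Real.log T) = (Δmin / (4 * c * N)) ^ 2 * L := by
        simp only [L]; field_simp; ring
      rw [this]
      gcongr
    have e2 : Δmin / (2 * c * N) = 2 * (Δmin / (4 * c * N)) := by field_simp; ring
    rw [e, e2]
    linarith
  have h3 := Finset.sum_lt_sum_of_nonempty (Finset.nonempty_iff_ne_empty.2 hN) hlt
  obtain ⟨k, -⟩ := Finset.nonempty_iff_ne_empty.2 hN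
  have hN0 : (0 : ℝ) < N := by exact_mod_cast (Nat.zero_le _).trans_lt k.isLt
  have h4 : ∑ _k ∈ a.observed (t + 1) s, Δmin / (2 * c * N) ≤ N * (Δmin / (2 * c * N)) := by
    rw [Finset.sum_const, nsmul_eq_mul]
    gcongr
    simpa using Finset.card_le_univ (a.observed (t + 1) s)
  have h5 : 2 * c * (N * (Δmin / (2 * c * N))) = Δmin := by field_simp
  have h6 := mul_lt_mul_of_pos_left (h3.trans_le h4) (by positivity : 0 < 2 * c)
  linarith

end Algorithm

end EnvyBandit

/-! ### Measurability of the algorithm -/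

namespace EnvyBandit

/-- A map into a finite type with measurable fibers is measurable after composition with any
function. -/
lemma measurable_comp_of_fibers {β γ δ : Type*} [MeasurableSpace β] [MeasurableSpace δ] [Finite γ]
    {f : β → γ} (hf : ∀ y, MeasurableSet {x | f x = y}) (g : γ → δ) :
    Measurable fun x => g (f x) := by
  intro s _
  have : (fun x => g (f x)) ⁻¹' s = ⋃ y ∈ {y | g y ∈ s}, {x | f x = y} := by
    ext x; simp
  rw [this]
  exact MeasurableSet.biUnion (Set.to_countable _) fun y _ => hf y

section Bounds

variable {N : ℕ} {β : Type*} [MeasurableSpace β] {s : β → Stats N}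

lemma measurable_bonus (hcount : ∀ i, Measurable fun x => (s x).count i) (α σ : ℝ) (t : ℕ)
    (i : Fin N) : Measurable fun x => bonus α σ t (s x) i := by
  have : Measurable fun x => ((s x).count i : ℝ) := measurable_from_top.comp (hcount i)
  unfold bonus
  fun_prop

lemma measurable_ucb (hcount : ∀ i, Measurable fun x => (s x).count i)
    (htotal : ∀ i, Measurable fun x => (s x).total i) (α σ : ℝ) (t : ℕ) :
    Measurable fun x => ucb α σ t (s x) :=
  measurable_pi_lambda _ fun i =>
    ((htotal i).div (measurable_from_top.comp (hcount i))).add (measurable_bonus hcount α σ t i)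

lemma measurable_lcb (hcount : ∀ i, Measurable fun x => (s x).count i)
    (htotal : ∀ i, Measurable fun x => (s x).total i) (α σ : ℝ) (t : ℕ) :
    Measurable fun x => lcb α σ t (s x) :=
  measurable_pi_lambda _ fun i =>
    ((htotal i).div (measurable_from_top.comp (hcount i))).sub (measurable_bonus hcount α σ t i)

end Bounds

namespace Algorithm

variable {K N : ℕ} {a : Algorithm K N} {A : Fin K → Set (Finset (Fin N))} {r : Reward K N}

section Measurability

variable {β : Type*} [MeasurableSpace β] {s : β → Stats N}

lemma measurableSet_choose_eq (hO : IsMinEnvyOracle A r a.minOracle)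
    (hcount : ∀ i, Measurable fun x => (s x).count i)
    (htotal : ∀ i, Measurable fun x => (s x).total i) (t : ℕ) (φ : Assignment K N) :
    MeasurableSet {x | a.choose t (s x) = φ} := by
  unfold choose
  split_ifs
  · exact MeasurableSet.const _
  · exact ((measurable_lcb hcount htotal a.α a.σ t).prodMk
      (measurable_ucb hcount htotal a.α a.σ t)) (hO.measurable φ)

lemma measurableSet_mem_observed (hO : IsMinEnvyOracle A r a.minOracle)
    (hQ : IsMaxPairOracle A r a.pairOracle)
    (hcount : ∀ i, Measurable fun x => (s x).count i)
    (htotal : ∀ i, Measurable fun x => (s x).total i) (t : ℕ) (i : Fin N) :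
    MeasurableSet {x | i ∈ a.observed t (s x)} := by
  unfold observed
  split_ifs
  · exact MeasurableSet.const _
  -- Pair-oracle measurability is available only for a fixed allocation, so the event is split over
  -- the finitely many values of allocation and pair.
  · have : {x | i ∈ a.choose t (s x) (a.pairOracle (ucb a.α a.σ t (s x)) (lcb a.α a.σ t (s x))
          (a.choose t (s x))).1 ∪ a.choose t (s x) (a.pairOracle (ucb a.α a.σ t (s x))
          (lcb a.α a.σ t (s x)) (a.choose t (s x))).2} =
        ⋃ φ : Assignment K N, ⋃ p : Fin K × Fin K, {x | a.choose t (s x) = φ} ∩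
          ({x | a.pairOracle (ucb a.α a.σ t (s x)) (lcb a.α a.σ t (s x)) φ = p} ∩
            {_x | i ∈ φ p.1 ∪ φ p.2}) := by
      ext x
      simp only [Set.mem_ofPred_eq, Set.mem_iUnion, Set.mem_inter_iff]
      constructor
      · intro h
        exact ⟨_, _, rfl, rfl, h⟩
      · rintro ⟨φ, p, rfl, rfl, h⟩
        exact h
    simp only [this]
    refine MeasurableSet.iUnion fun φ => MeasurableSet.iUnion fun p =>
      (measurableSet_choose_eq hO hcount htotal t φ).inter
        (MeasurableSet.inter ?_ (MeasurableSet.const _))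
    exact ((measurable_ucb hcount htotal a.α a.σ t).prodMk
      (measurable_lcb hcount htotal a.α a.σ t)) (hQ.measurable φ p)

lemma measurable_stats (hO : IsMinEnvyOracle A r a.minOracle)
    (hQ : IsMaxPairOracle A r a.pairOracle) (t : ℕ) :
    (∀ i, Measurable fun X : ℕ → Fin N → ℝ => (a.stats X t).count i) ∧
      ∀ i, Measurable fun X : ℕ → Fin N → ℝ => (a.stats X t).total i := by
  induction t with
  | zero => exact ⟨fun i => measurable_const, fun i => measurable_const⟩
  | succ t ih =>
    have hP := measurableSet_mem_observed hO hQ ih.1 ih.2 (t + 1)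
    refine ⟨fun i => ?_, fun i => ?_⟩
    · simp only [stats_count_succ]
      exact (ih.1 i).add (Measurable.ite (hP i) measurable_const measurable_const)
    · simp only [stats_total_succ]
      exact (ih.2 i).add (Measurable.ite (hP i)
        ((measurable_pi_apply i).comp (measurable_pi_apply (t + 1))) measurable_const)

end Measurability

/-! ### Concentration under adaptive observation -/

section Concentration

open scoped ENNReal

variable {Ω : Type*} [MeasurableSpace Ω] {P : Measure Ω} {σ : ℝ} {ε : ℕ → Ω → Fin N → ℝ}

lemma _root_.EnvyBandit.IsNoise.measurable_noisy (hε : IsNoise P σ ε) (μ : Fin N → ℝ) :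
    Measurable fun ω => fun (t : ℕ) (i : Fin N) => μ i + ε t ω i :=
  measurable_pi_lambda _ fun t => measurable_pi_lambda _ fun i =>
    measurable_const.add ((measurable_pi_apply i).comp (hε.measurable t))

/-- The noise of a round is independent of everything that depends on the earlier rounds only. -/
lemma _root_.EnvyBandit.IsNoise.indepFun_past (hε : IsNoise P σ ε) (μ : Fin N → ℝ) (t : ℕ)
    {G : (ℕ → Fin N → ℝ) → ℝ≥0∞} (hG : Measurable G)
    (hcongr : ∀ X Y, (∀ s ≤ t, X s = Y s) → G X = G Y) :
    IndepFun (fun ω => G fun s i => μ i + ε s ω i) (ε (t + 1)) P := by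
  have h := hε.indep.indepFun_finset (Finset.range (t + 1)) {t + 1} (by simp) hε.measurable
  -- Rebuilds a full path from the noise up to index `t`, padded by zeros that `G` cannot see by
  -- `hcongr`.
  let ext : (Finset.range (t + 1) → Fin N → ℝ) → ℕ → Fin N → ℝ :=
    fun z s => if hs : s ∈ Finset.range (t + 1) then fun i => μ i + z ⟨s, hs⟩ i else 0
  have hext : Measurable ext := by
    refine measurable_pi_lambda _ fun s => ?_
    by_cases hs : s ∈ Finset.range (t + 1)
    · simp only [ext, dif_pos hs]
      fun_prop
    · simp only [ext, dif_neg hs]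
      exact measurable_const
  have h2 := h.comp (hG.comp hext)
    (measurable_pi_apply (⟨t + 1, Finset.mem_singleton_self _⟩ : ({t + 1} : Finset ℕ)))
  refine h2.congr (Filter.Eventually.of_forall fun ω => ?_)
    (Filter.Eventually.of_forall fun ω => rfl)
  refine hcongr _ _ fun s hs => ?_
  have : s ∈ Finset.range (t + 1) := Finset.mem_range.2 (by omega)
  simp only [ext, dif_pos this]

/-- The exponential supermartingale of the deviations of the observed qualities of good `i`. -/
noncomputable def expDeviation (a : Algorithm K N) (μ : Fin N → ℝ) (lam : ℝ) (i : Fin N) (t : ℕ)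
    (X : ℕ → Fin N → ℝ) : ℝ≥0∞ :=
  ENNReal.ofReal (Real.exp (lam * ((a.stats X t).total i - (a.stats X t).count i * μ i) -
    a.σ ^ 2 * lam ^ 2 / 2 * (a.stats X t).count i))

lemma expDeviation_congr (μ : Fin N → ℝ) (lam : ℝ) (i : Fin N) {t : ℕ} {X Y : ℕ → Fin N → ℝ}
    (h : ∀ s ≤ t, X s = Y s) : a.expDeviation μ lam i t X = a.expDeviation μ lam i t Y := by
  simp only [expDeviation, a.stats_congr t h]

lemma measurable_expDeviation (hO : IsMinEnvyOracle A r a.minOracle)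
    (hQ : IsMaxPairOracle A r a.pairOracle) (μ : Fin N → ℝ) (lam : ℝ) (i : Fin N) (t : ℕ) :
    Measurable (a.expDeviation μ lam i t) := by
  have h1 : Measurable fun X : ℕ → Fin N → ℝ => ((a.stats X t).count i : ℝ) :=
    measurable_from_top.comp ((measurable_stats hO hQ t).1 i)
  have h2 := (measurable_stats hO hQ t).2 i
  unfold expDeviation
  fun_prop

/-- One step of the supermartingale: a factor is only added if the good is observed. -/
lemma expDeviation_succ (μ : Fin N → ℝ) (lam : ℝ) (i : Fin N) (t : ℕ) (X : ℕ → Fin N → ℝ) :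
    a.expDeviation μ lam i (t + 1) X =
      {X | i ∉ a.observed (t + 1) (a.stats X t)}.indicator (a.expDeviation μ lam i t) X +
      {X | i ∈ a.observed (t + 1) (a.stats X t)}.indicator (a.expDeviation μ lam i t) X *
        ENNReal.ofReal (Real.exp (lam * (X (t + 1) i - μ i) - a.σ ^ 2 * lam ^ 2 / 2)) := by
  by_cases h : i ∈ a.observed (t + 1) (a.stats X t)
  · rw [Set.indicator_of_notMem (by simpa using h), zero_add, Set.indicator_of_mem (by exact h),
      expDeviation, expDeviation, ← ENNReal.ofReal_mul (Real.exp_nonneg _), ← Real.exp_add,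
      stats_count_succ, stats_total_succ, if_pos h, if_pos h]
    congr 2
    push_cast
    ring
  · rw [Set.indicator_of_mem (by exact h), Set.indicator_of_notMem (by simpa using h), zero_mul,
      add_zero, expDeviation, expDeviation, stats_count_succ, stats_total_succ, if_neg h, if_neg h]
    simp

lemma lintegral_exp_noise_le (hε : IsNoise P σ ε) (lam : ℝ) (t : ℕ) (i : Fin N) :
    ∫⁻ ω, ENNReal.ofReal (Real.exp (lam * ε t ω i - σ ^ 2 * lam ^ 2 / 2)) ∂P ≤ 1 := by
  have h := hε.subgaussian t i
  have e : ∀ ω, Real.exp (lam * ε t ω i - σ ^ 2 * lam ^ 2 / 2) =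
      Real.exp (lam * ε t ω i) * Real.exp (-(σ ^ 2 * lam ^ 2 / 2)) := fun ω => by
    rw [← Real.exp_add]; rfl
  simp only [e]
  rw [← ofReal_integral_eq_lintegral_ofReal ((h.integrable_exp_mul lam).mul_const _)
    (Filter.Eventually.of_forall fun ω => by positivity), integral_mul_const]
  refine ENNReal.ofReal_le_one.2 ?_
  calc _ ≤ Real.exp (σ ^ 2 * lam ^ 2 / 2) * Real.exp (-(σ ^ 2 * lam ^ 2 / 2)) :=
        mul_le_mul_of_nonneg_right (h.mgf_le lam) (Real.exp_nonneg _)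
    _ = 1 := by rw [← Real.exp_add]; simp

/-- Whether good `i` is observed in round `t + 1` is determined by the past. The new factor is
therefore independent of what it multiplies, and subgaussianity bounds its mean by 1. -/
lemma lintegral_expDeviation_le [IsProbabilityMeasure P] (hO : IsMinEnvyOracle A r a.minOracle)
    (hQ : IsMaxPairOracle A r a.pairOracle) (hε : IsNoise P a.σ ε) (μ : Fin N → ℝ) (lam : ℝ)
    (i : Fin N) (t : ℕ) :
    ∫⁻ ω, a.expDeviation μ lam i t (fun s i => μ i + ε s ω i) ∂P ≤ 1 := by
  induction t with
  | zero => simp [expDeviation, stats]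
  | succ t ih =>
    refine le_trans ?_ ih
    have hst := measurable_stats (a := a) hO hQ t
    have hS : MeasurableSet {X | i ∈ a.observed (t + 1) (a.stats X t)} :=
      measurableSet_mem_observed hO hQ hst.1 hst.2 (t + 1) i
    have hM := measurable_expDeviation (a := a) hO hQ μ lam i t
    have hX := hε.measurable_noisy μ
    set X : Ω → ℕ → Fin N → ℝ := fun ω s i => μ i + ε s ω i
    let G := {X | i ∈ a.observed (t + 1) (a.stats X t)}.indicator (a.expDeviation μ lam i t)
    let G' := {X | i ∉ a.observed (t + 1) (a.stats X t)}.indicator (a.expDeviation μ lam i t)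
    have hG : Measurable G := hM.indicator hS
    have hG' : Measurable fun ω => G' (X ω) := (hM.indicator hS.compl).comp hX
    let H : (Fin N → ℝ) → ℝ≥0∞ := fun z =>
      ENNReal.ofReal (Real.exp (lam * z i - a.σ ^ 2 * lam ^ 2 / 2))
    have hH : Measurable H := by
      simp only [H]
      fun_prop
    have hind : IndepFun (fun ω => G (X ω)) (fun ω => H (ε (t + 1) ω)) P := by
      refine (hε.indepFun_past μ t hG fun X Y hXY => ?_).comp measurable_id hH
      simp only [G, Set.indicator, Set.mem_ofPred_eq, a.stats_congr t hXY,
        expDeviation_congr μ lam i hXY]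
      congr
    calc ∫⁻ ω, a.expDeviation μ lam i (t + 1) (X ω) ∂P
        = ∫⁻ ω, (G' (X ω) + G (X ω) * H (ε (t + 1) ω)) ∂P := by
          refine lintegral_congr fun ω => ?_
          rw [expDeviation_succ]
          simp only [G, G', H, X, add_sub_cancel_left]
      _ = ∫⁻ ω, G' (X ω) ∂P + (∫⁻ ω, G (X ω) ∂P) * ∫⁻ ω, H (ε (t + 1) ω) ∂P := by
          rw [lintegral_add_left hG']
          exact congrArg _ (lintegral_mul_eq_lintegral_mul_lintegral_of_indepFun''
            (hG.comp hX).aemeasurable (hH.comp (hε.measurable _)).aemeasurable hind)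
      _ ≤ ∫⁻ ω, G' (X ω) ∂P + (∫⁻ ω, G (X ω) ∂P) * 1 := by
          gcongr
          exact lintegral_exp_noise_le hε lam (t + 1) i
      _ = ∫⁻ ω, a.expDeviation μ lam i t (X ω) ∂P := by
          rw [mul_one, ← lintegral_add_left hG']
          refine lintegral_congr fun ω => ?_
          by_cases h : i ∈ a.observed (t + 1) (a.stats (X ω) t) <;> simp [G, G', h]

/-- Deviation inequality for a fixed number `n` of observations, in the direction given by the
sign of `δ`. -/
lemma measure_deviation_le [IsProbabilityMeasure P] (hO : IsMinEnvyOracle A r a.minOracle)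
    (hQ : IsMaxPairOracle A r a.pairOracle) (hε : IsNoise P a.σ ε) (hσ : 0 < a.σ)
    (μ : Fin N → ℝ) (i : Fin N) (t n : ℕ) (δ b : ℝ) (hb : δ ^ 2 * n = 2 * a.σ ^ 2 * b) :
    P {ω | (a.stats (fun s i => μ i + ε s ω i) t).count i = n ∧
      n * δ ^ 2 ≤ δ * ((a.stats (fun s i => μ i + ε s ω i) t).total i - n * μ i)} ≤
      ENNReal.ofReal (Real.exp (-b)) := by
  set X : Ω → ℕ → Fin N → ℝ := fun ω s i => μ i + ε s ω i
  -- Markov's inequality with the optimal Chernoff parameter `δ / σ ^ 2`: on the event the exponent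
  -- is at least `n * δ ^ 2 / σ ^ 2 - n * δ ^ 2 / (2 * σ ^ 2) = b`.
  have hmeas := (measurable_expDeviation (a := a) hO hQ μ (δ / a.σ ^ 2) i t).comp
    (hε.measurable_noisy μ)
  have h1 := meas_ge_le_lintegral_div hmeas.aemeasurable (μ := P)
    (ε := ENNReal.ofReal (Real.exp b)) (by simp [Real.exp_pos]) ENNReal.ofReal_ne_top
  have h2 : (∫⁻ ω, a.expDeviation μ (δ / a.σ ^ 2) i t (X ω) ∂P) / ENNReal.ofReal (Real.exp b) ≤
      ENNReal.ofReal (Real.exp (-b)) := by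
    rw [Real.exp_neg, ENNReal.ofReal_inv_of_pos (Real.exp_pos b), ← one_div]
    exact ENNReal.div_le_div_right (lintegral_expDeviation_le hO hQ hε μ _ i t) _
  refine (measure_mono ?_).trans (h1.trans h2)
  rintro ω ⟨hn, hω⟩
  refine ENNReal.ofReal_le_ofReal (Real.exp_le_exp.2 ?_)
  simp only [hn]
  have e : a.σ ^ 2 * (δ / a.σ ^ 2) ^ 2 / 2 * n = b := by
    field_simp
    linarith
  have e2 : 2 * b = n * δ ^ 2 / a.σ ^ 2 := by
    field_simp
    linarith
  have h3 := div_le_div_of_nonneg_right hω (sq_nonneg a.σ)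
  rw [e, div_mul_eq_mul_div]
  linarith

/-- In round `t + 1`, the confidence interval of an observed good fails to contain its quality
with probability at most `2 (t + 1) ^ (1 - α)`. -/
lemma measure_not_mem_confidence_le [IsProbabilityMeasure P]
    (hO : IsMinEnvyOracle A r a.minOracle) (hQ : IsMaxPairOracle A r a.pairOracle)
    (hε : IsNoise P a.σ ε) (hσ : 0 < a.σ) (hα : 0 ≤ a.α) (μ : Fin N → ℝ) (i : Fin N) {t : ℕ}
    (ht : (i : ℕ) < t) :
    P {ω | ¬ (lcb a.α a.σ (t + 1) (a.stats (fun s i => μ i + ε s ω i) t) i ≤ μ i ∧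
      μ i ≤ ucb a.α a.σ (t + 1) (a.stats (fun s i => μ i + ε s ω i) t) i)} ≤
      ENNReal.ofReal (2 * ((t + 1 : ℕ) : ℝ) ^ (1 - a.α)) := by
  set X : Ω → ℕ → Fin N → ℝ := fun ω s i => μ i + ε s ω i
  set b := a.α * Real.log ((t + 1 : ℕ) : ℝ) with hbdef
  have hb0 : 0 ≤ b := mul_nonneg hα (Real.log_natCast_nonneg _)
  have htpos : (0 : ℝ) < ((t + 1 : ℕ) : ℝ) := by positivity
  let δ : ℕ → ℝ := fun n => Real.sqrt (1 / (n : ℝ) * (2 * a.σ ^ 2 * b))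
  let E : ℝ → ℕ → Set Ω := fun δ n => {ω | (a.stats (X ω) t).count i = n ∧
      n * δ ^ 2 ≤ δ * ((a.stats (X ω) t).total i - n * μ i)}
  have hδ : ∀ n ∈ Finset.Icc 1 t, δ n ^ 2 * n = 2 * a.σ ^ 2 * b := by
    intro n hn
    have : (0 : ℝ) < n := by exact_mod_cast (Finset.mem_Icc.1 hn).1
    rw [Real.sq_sqrt (by positivity)]
    field_simp
  -- The count is random and depends on the observed values, so all its possible values `1, …, t`
  -- are covered. This costs a factor `t` and turns the exponent `-α` into `1 - α`.
  have hsub : {ω | ¬ (lcb a.α a.σ (t + 1) (a.stats (X ω) t) i ≤ μ i ∧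
      μ i ≤ ucb a.α a.σ (t + 1) (a.stats (X ω) t) i)} ⊆
      ⋃ n ∈ Finset.Icc 1 t, (E (δ n) n ∪ E (-δ n) n) := by
    intro ω hω
    have hn1 := a.stats_count_pos (X ω) ht
    have hn2 := a.stats_count_le (X ω) i t
    refine Set.mem_iUnion₂.2 ⟨_, Finset.mem_Icc.2 ⟨hn1, hn2⟩, ?_⟩
    have hbonus : bonus a.α a.σ (t + 1) (a.stats (X ω) t) i = δ ((a.stats (X ω) t).count i) := by
      simp only [bonus, δ, b, Real.log_rpow htpos]
    simp only [lcb, ucb, hbonus, Set.mem_ofPred_eq] at hω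
    set n := (a.stats (X ω) t).count i with hn
    have hδ0 : 0 ≤ δ n := Real.sqrt_nonneg _
    have hn0 : (0 : ℝ) < n := by exact_mod_cast hn1
    set S := (a.stats (X ω) t).total i
    have hS : S = n * (S / n) := by field_simp
    rw [not_and_or, not_le, not_le] at hω
    rcases hω with hω | hω
    · left
      refine ⟨rfl, ?_⟩
      have : n * δ n ≤ S - n * μ i := by
        rw [hS, ← mul_sub]
        exact mul_le_mul_of_nonneg_left (by linarith) hn0.le
      calc n * δ n ^ 2 = δ n * (n * δ n) := by ring
        _ ≤ _ := mul_le_mul_of_nonneg_left this hδ0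
    · right
      refine ⟨rfl, ?_⟩
      have : n * δ n ≤ n * μ i - S := by
        rw [hS, ← mul_sub]
        exact mul_le_mul_of_nonneg_left (by linarith) hn0.le
      calc n * (-δ n) ^ 2 = δ n * (n * δ n) := by ring
        _ ≤ δ n * (n * μ i - S) := mul_le_mul_of_nonneg_left this hδ0
        _ = _ := by ring
  have hE : ∀ n ∈ Finset.Icc 1 t, P (E (δ n) n ∪ E (-δ n) n) ≤
      ENNReal.ofReal (2 * Real.exp (-b)) := by
    intro n hn
    rw [two_mul, ENNReal.ofReal_add (Real.exp_nonneg _) (Real.exp_nonneg _)]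
    refine (measure_union_le _ _).trans (add_le_add ?_ ?_)
    · exact measure_deviation_le hO hQ hε hσ μ i t n (δ n) b (hδ n hn)
    · exact measure_deviation_le hO hQ hε hσ μ i t n (-δ n) b (by rw [neg_sq]; exact hδ n hn)
  calc _ ≤ ∑ n ∈ Finset.Icc 1 t, P (E (δ n) n ∪ E (-δ n) n) :=
        (measure_mono hsub).trans (measure_biUnion_finset_le _ _)
    _ ≤ ∑ _n ∈ Finset.Icc 1 t, ENNReal.ofReal (2 * Real.exp (-b)) := Finset.sum_le_sum hE
    _ = ENNReal.ofReal (t * (2 * Real.exp (-b))) := by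
        rw [Finset.sum_const, nsmul_eq_mul, ENNReal.ofReal_mul (Nat.cast_nonneg t)]
        simp
    _ ≤ _ := by
        refine ENNReal.ofReal_le_ofReal ?_
        have : Real.exp (-b) = ((t + 1 : ℕ) : ℝ) ^ (-a.α) := by
          rw [Real.rpow_def_of_pos htpos, hbdef]
          ring_nf
        rw [sub_eq_add_neg, Real.rpow_add htpos, Real.rpow_one, this]
        have h0 : (0 : ℝ) ≤ ((t + 1 : ℕ) : ℝ) ^ (-a.α) := by positivity
        push_cast at h0 ⊢
        linarith

end Concentration

end Algorithm

end EnvyBandit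

/-! ### Regret decomposition and expectation -/

namespace EnvyBandit

lemma integrable_comp_of_fibers {Ω γ : Type*} [MeasurableSpace Ω] {P : Measure Ω}
    [IsFiniteMeasure P] [Finite γ] {f : Ω → γ} (hf : ∀ y, MeasurableSet {x | f x = y})
    (g : γ → ℝ) : Integrable (fun x => g (f x)) P := by
  obtain ⟨b, hb⟩ := (Set.finite_range fun y => ‖g y‖).bddAbove
  exact Integrable.of_bound (measurable_comp_of_fibers hf g).aestronglyMeasurable b
    (Filter.Eventually.of_forall fun x => hb ⟨f x, rfl⟩)

namespace Algorithm

variable {K N : ℕ} {a : Algorithm K N} {A : Fin K → Set (Finset (Fin N))} {r : Reward K N}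
  {c Δmin Δmax : ℝ} {μ : Fin N → ℝ} {ψ : Assignment K N}

/-- The realizations for which some confidence interval of round `t + 1` is wrong. -/
def confidenceFailure (a : Algorithm K N) (μ : Fin N → ℝ) (t : ℕ) : Set (ℕ → Fin N → ℝ) :=
  {X | ∃ i, ¬ (lcb a.α a.σ (t + 1) (a.stats X t) i ≤ μ i ∧
    μ i ≤ ucb a.α a.σ (t + 1) (a.stats X t) i)}

lemma cumulativeExcess_eq (X : ℕ → Fin N → ℝ) (T : ℕ) : a.cumulativeExcess r μ ψ X T =
    ∑ t ∈ Finset.range T, (envy r μ (a.allocation X (t + 1)) - envy r μ ψ) := by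
  rw [cumulativeExcess, ← Finset.Ico_add_one_right_eq_Icc, Finset.sum_Ico_eq_sum_range]
  simp [add_comm]

/-- The cumulative excess envy is controlled by the initial rounds, the rounds in which a rarely
observed good is observed, and the rounds with wrong confidence intervals. -/
lemma cumulativeExcess_le (hLM : LipschitzMonotone A r c) (hgap : EnvyGap A r μ Δmin Δmax)
    (hK : 1 ≤ K) (hc : 0 < c) (hΔ : 0 < Δmin) (hΔ' : 0 ≤ Δmax) (hα : 0 ≤ a.α)
    (hO : IsMinEnvyOracle A r a.minOracle) (hQ : IsMaxPairOracle A r a.pairOracle)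
    (hinit : ∀ t, a.initial t ∈ allocations A) (hψ : ψ ∈ minEnvyAllocations A r μ)
    (X : ℕ → Fin N → ℝ) {T : ℕ} (hT : N ≤ T) :
    a.cumulativeExcess r μ ψ X T ≤ Δmax * (N + N * (32 * c ^ 2 * N ^ 2 * a.σ ^ 2 * a.α *
      Real.log T / Δmin ^ 2 + 1) +
        ∑ t ∈ Finset.Ico N T, (a.confidenceFailure μ t).indicator 1 X) := by
  classical
  set L := 32 * c ^ 2 * N ^ 2 * a.σ ^ 2 * a.α * Real.log T / Δmin ^ 2
  have hlog : 0 ≤ Real.log T := Real.log_natCast_nonneg T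
  have hL : 0 ≤ L := by positivity
  let q : Fin N → ℕ → Prop := fun i t =>
    i ∈ a.observed (t + 1) (a.stats X t) ∧ (a.stats X t).count i ≤ ⌊L⌋₊
  let bad : ℕ → ℝ := fun t => (a.confidenceFailure μ t).indicator 1 X
  have hbad : ∀ t, 0 ≤ bad t := fun t => Set.indicator_nonneg (fun _ _ => zero_le_one) X
  have hq : ∀ t, 0 ≤ ∑ i, if q i t then (1 : ℝ) else 0 := fun t =>
    Finset.sum_nonneg fun i _ => by positivity
  have hexcess : ∀ t, envy r μ (a.allocation X (t + 1)) - envy r μ ψ ≤ Δmax := fun t =>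
    hgap.envy_sub_le hK hΔ' (allocation_mem X hO hinit _)
  have hsum := cumulativeExcess_eq (a := a) (r := r) (μ := μ) (ψ := ψ) X T
  rw [Finset.range_eq_Ico, ← Finset.sum_Ico_consecutive _ (Nat.zero_le N) hT] at hsum
  have h1 : ∑ t ∈ Finset.Ico 0 N, (envy r μ (a.allocation X (t + 1)) - envy r μ ψ) ≤ Δmax * N := by
    refine (Finset.sum_le_sum fun t _ => hexcess t).trans ?_
    simp [mul_comm]
  -- A suboptimal round either has a wrong interval or observes a rare good, so the bracket is at
  -- least 1; an optimal round has no positive excess.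
  have h2 : ∀ t ∈ Finset.Ico N T, envy r μ (a.allocation X (t + 1)) - envy r μ ψ ≤
      Δmax * ((∑ i, if q i t then (1 : ℝ) else 0) + bad t) := by
    intro t ht
    rw [Finset.mem_Ico] at ht
    by_cases hopt : a.allocation X (t + 1) ∈ minEnvyAllocations A r μ
    · have := hopt.2 ψ hψ.1
      have h0 := mul_nonneg hΔ' (add_nonneg (hq t) (hbad t))
      linarith
    · refine (hexcess t).trans (le_mul_of_one_le_right hΔ' ?_)
      by_cases hf : X ∈ a.confidenceFailure μ t
      · have : bad t = 1 := by simp [bad, hf]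
        linarith [hq t]
      · simp only [confidenceFailure, Set.mem_ofPred_eq, not_exists, not_not] at hf
        obtain ⟨i, hi, hcount⟩ := exists_count_le X hLM hgap hK hc hΔ hα hO hQ hψ ht.1 ht.2
          (fun i => (hf i).1) (fun i => (hf i).2) hopt
        have hqi : q i t := ⟨hi, Nat.le_floor hcount⟩
        have : (if q i t then (1 : ℝ) else 0) ≤ ∑ i, if q i t then (1 : ℝ) else 0 :=
          Finset.single_le_sum (f := fun i => if q i t then (1 : ℝ) else 0)
            (fun i _ => by positivity) (Finset.mem_univ i)
        rw [if_pos hqi] at this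
        linarith [hbad t]
  have h3 : ∑ t ∈ Finset.Ico N T, ∑ i, (if q i t then (1 : ℝ) else 0) ≤ N * (L + 1) := by
    rw [Finset.sum_comm]
    calc _ ≤ ∑ _i : Fin N, (L + 1) := Finset.sum_le_sum fun i _ => ?_
      _ = N * (L + 1) := by simp [mul_add]
    rw [Finset.sum_boole]
    have hsub : (Finset.Ico N T).filter (q i) ⊆ (Finset.range T).filter (q i) :=
      Finset.filter_subset_filter _ fun t ht => Finset.mem_range.2 (Finset.mem_Ico.1 ht).2
    have hcard : ((((Finset.Ico N T).filter (q i)).card : ℕ) : ℝ) ≤ ((⌊L⌋₊ + 1 : ℕ) : ℝ) := by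
      exact_mod_cast (Finset.card_le_card hsub).trans (a.card_observed_le X i ⌊L⌋₊ T)
    push_cast at hcard
    linarith [Nat.floor_le hL]
  have h4 := Finset.sum_le_sum h2
  rw [← Finset.mul_sum, Finset.sum_add_distrib] at h4
  have h5 := mul_le_mul_of_nonneg_left h3 hΔ'
  rw [hsum, mul_add, mul_add]
  rw [mul_add] at h4
  linarith

section Probability

variable {Ω : Type*} [MeasurableSpace Ω] {P : Measure Ω} [IsProbabilityMeasure P]
  {ε : ℕ → Ω → Fin N → ℝ}

lemma integrable_cumulativeExcess (hO : IsMinEnvyOracle A r a.minOracle)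
    (hQ : IsMaxPairOracle A r a.pairOracle) {σ : ℝ} (hε : IsNoise P σ ε) (T : ℕ) :
    Integrable (fun ω => a.cumulativeExcess r μ ψ (fun t i => μ i + ε t ω i) T) P := by
  simp only [cumulativeExcess_eq]
  refine integrable_finsetSum _ fun t _ => ?_
  have hst := measurable_stats (a := a) hO hQ t
  have hX := hε.measurable_noisy μ
  exact integrable_comp_of_fibers (measurableSet_choose_eq hO (fun i => (hst.1 i).comp hX)
    (fun i => (hst.2 i).comp hX) (t + 1)) fun φ => envy r μ φ - envy r μ ψ

lemma measurableSet_confidenceFailure (hO : IsMinEnvyOracle A r a.minOracle)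
    (hQ : IsMaxPairOracle A r a.pairOracle) (t : ℕ) :
    MeasurableSet (a.confidenceFailure μ t) := by
  have hst := measurable_stats (a := a) hO hQ t
  have hl := measurable_lcb hst.1 hst.2 a.α a.σ (t + 1)
  have hu := measurable_ucb hst.1 hst.2 a.α a.σ (t + 1)
  have : a.confidenceFailure μ t = ⋃ i, ({X | lcb a.α a.σ (t + 1) (a.stats X t) i ≤ μ i} ∩
      {X | μ i ≤ ucb a.α a.σ (t + 1) (a.stats X t) i})ᶜ := by
    ext X
    simp only [confidenceFailure, Set.mem_ofPred_eq, Set.mem_iUnion, Set.mem_compl_iff,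
      Set.mem_inter_iff]
  rw [this]
  exact MeasurableSet.iUnion fun i =>
    ((measurableSet_le ((measurable_pi_apply i).comp hl) measurable_const).inter
      (measurableSet_le measurable_const ((measurable_pi_apply i).comp hu))).compl

lemma measureReal_confidenceFailure_le (hO : IsMinEnvyOracle A r a.minOracle)
    (hQ : IsMaxPairOracle A r a.pairOracle) (hε : IsNoise P a.σ ε) (hσ : 0 < a.σ) (hα : 0 ≤ a.α)
    {t : ℕ} (ht : N ≤ t) :
    P.real {ω | (fun s i => μ i + ε s ω i) ∈ a.confidenceFailure μ t} ≤
      N * (2 * ((t + 1 : ℕ) : ℝ) ^ (1 - a.α)) := by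
  have h0 : (0 : ℝ) ≤ 2 * ((t + 1 : ℕ) : ℝ) ^ (1 - a.α) := by positivity
  refine ENNReal.toReal_le_of_le_ofReal (by positivity) ?_
  have : {ω | (fun s i => μ i + ε s ω i) ∈ a.confidenceFailure μ t} =
      ⋃ i, {ω | ¬ (lcb a.α a.σ (t + 1) (a.stats (fun s i => μ i + ε s ω i) t) i ≤ μ i ∧
      μ i ≤ ucb a.α a.σ (t + 1) (a.stats (fun s i => μ i + ε s ω i) t) i)} := by
    ext ω
    simp only [confidenceFailure, Set.mem_ofPred_eq, Set.mem_iUnion]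
  rw [this]
  calc _ ≤ ∑ i : Fin N, _ := measure_iUnion_fintype_le _ _
    _ ≤ ∑ _i : Fin N, ENNReal.ofReal (2 * ((t + 1 : ℕ) : ℝ) ^ (1 - a.α)) :=
        Finset.sum_le_sum fun i _ =>
          measure_not_mem_confidence_le hO hQ hε hσ hα μ i (i.isLt.trans_le ht)
    _ = _ := by
        rw [Finset.sum_const, nsmul_eq_mul, ENNReal.ofReal_mul (Nat.cast_nonneg N)]
        simp

/-- This is where `α > 2` is needed: it makes the failure probabilities summable after the union
bound over counts. -/
lemma summable_rpow_succ {α : ℝ} (hα : 2 < α) :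
    Summable fun t : ℕ => ((t + 1 : ℕ) : ℝ) ^ (1 - α) :=
  (summable_nat_add_iff 1).2 (Real.summable_nat_rpow.2 (by linarith))

lemma integral_cumulativeExcess_le (hLM : LipschitzMonotone A r c)
    (hgap : EnvyGap A r μ Δmin Δmax) (hK : 1 ≤ K) (hc : 0 < c) (hΔ : 0 < Δmin) (hΔ' : 0 ≤ Δmax)
    (hα : 2 < a.α) (hσ : 0 < a.σ) (hO : IsMinEnvyOracle A r a.minOracle)
    (hQ : IsMaxPairOracle A r a.pairOracle) (hinit : ∀ t, a.initial t ∈ allocations A)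
    (hψ : ψ ∈ minEnvyAllocations A r μ) (hε : IsNoise P a.σ ε) {T : ℕ} (hT : N ≤ T) :
    ∫ ω, a.cumulativeExcess r μ ψ (fun t i => μ i + ε t ω i) T ∂P ≤
      Δmax * (N + N * (32 * c ^ 2 * N ^ 2 * a.σ ^ 2 * a.α * Real.log T / Δmin ^ 2 + 1) +
        2 * N * ∑' t : ℕ, ((t + 1 : ℕ) : ℝ) ^ (1 - a.α)) := by
  have hα0 : 0 ≤ a.α := by linarith
  have hX := hε.measurable_noisy μ
  set X : Ω → ℕ → Fin N → ℝ := fun ω t i => μ i + ε t ω i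
  set L := N + N * (32 * c ^ 2 * N ^ 2 * a.σ ^ 2 * a.α * Real.log T / Δmin ^ 2 + 1)
  let F : ℕ → Set Ω := fun t => {ω | X ω ∈ a.confidenceFailure μ t}
  have hF : ∀ t, MeasurableSet (F t) := fun t => hX (measurableSet_confidenceFailure hO hQ t)
  have hint : ∀ t, Integrable ((F t).indicator (1 : Ω → ℝ)) P := fun t =>
    (integrable_const (1 : ℝ)).indicator (hF t)
  have hsumint : Integrable (fun ω => ∑ t ∈ Finset.Ico N T, (F t).indicator (1 : Ω → ℝ) ω) P :=
    integrable_finsetSum _ fun t _ => hint t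
  calc ∫ ω, a.cumulativeExcess r μ ψ (X ω) T ∂P
      ≤ ∫ ω, Δmax * (L + ∑ t ∈ Finset.Ico N T, (F t).indicator (1 : Ω → ℝ) ω) ∂P :=
        integral_mono (integrable_cumulativeExcess hO hQ hε T)
          (((integrable_const L).add hsumint).const_mul Δmax)
          fun ω => cumulativeExcess_le hLM hgap hK hc hΔ hΔ' hα0 hO hQ hinit hψ (X ω) hT
    _ = Δmax * (L + ∑ t ∈ Finset.Ico N T, P.real (F t)) := by
        rw [integral_const_mul, integral_add (integrable_const L) hsumint,
          integral_finsetSum _ fun t _ => hint t]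
        simp [integral_indicator_one, hF]
    _ ≤ _ := by
        refine mul_le_mul_of_nonneg_left (add_le_add_right ?_ L) hΔ'
        calc ∑ t ∈ Finset.Ico N T, P.real (F t)
            ≤ ∑ t ∈ Finset.Ico N T, N * (2 * ((t + 1 : ℕ) : ℝ) ^ (1 - a.α)) :=
              Finset.sum_le_sum fun t ht => measureReal_confidenceFailure_le hO hQ hε hσ hα0
                (Finset.mem_Ico.1 ht).1
          _ = 2 * N * ∑ t ∈ Finset.Ico N T, ((t + 1 : ℕ) : ℝ) ^ (1 - a.α) := by
              rw [Finset.mul_sum]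
              exact Finset.sum_congr rfl fun t _ => by ring
          _ ≤ _ := mul_le_mul_of_nonneg_left
              ((summable_rpow_succ hα).sum_le_tsum _ fun t _ => by positivity) (by positivity)

end Probability

end Algorithm

end EnvyBandit

/-! ### Absorbing the lower-order terms -/

theorem theorem4 (α σ c Δmax : ℝ) (hα : 2 < α) (hσ : 0 < σ) (hc : 0 < c) (hΔmax : 0 < Δmax) :
    ∃ C : ℝ, 0 < C ∧
      ∀ (K N : ℕ) (A : Fin K → Set (Finset (Fin N))) (r : EnvyBandit.Reward K N) (μ : Fin N → ℝ)
        (Δmin : ℝ), 1 ≤ K → 0 < Δmin →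
        EnvyBandit.LipschitzMonotone A r c →
        EnvyBandit.EnvyGap A r μ Δmin Δmax →
        ∀ (a : EnvyBandit.Algorithm K N), a.α = α → a.σ = σ →
        EnvyBandit.IsMinEnvyOracle A r a.minOracle →
        EnvyBandit.IsMaxPairOracle A r a.pairOracle →
        (∀ t, a.initial t ∈ EnvyBandit.allocations A) →
        ∀ (Ω : Type*) [MeasurableSpace Ω] (P : Measure Ω) [IsProbabilityMeasure P]
          (ε : ℕ → Ω → Fin N → ℝ), EnvyBandit.IsNoise P σ ε →
        ∀ φopt ∈ EnvyBandit.minEnvyAllocations A r μ, ∀ T : ℕ, N < T →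
          Integrable (fun ω => a.cumulativeExcess r μ φopt (fun t i => μ i + ε t ω i) T) P ∧
          ∫ ω, a.cumulativeExcess r μ φopt (fun t i => μ i + ε t ω i) T ∂P ≤
            C * ((N : ℝ) ^ 3 * Real.log T / Δmin ^ 2) := by
  set Z := ∑' t : ℕ, ((t + 1 : ℕ) : ℝ) ^ (1 - α)
  have hZ : 0 ≤ Z := tsum_nonneg fun t => by positivity
  have hα0 : 0 < α := by linarith
  -- The second summand is the main counting term. The first absorbs `(2 + 2 * Z) * N`, from the
  -- initial rounds, the `+ 1` per good and the failures.
  refine ⟨Δmax * (4 * (1 + Z) * Δmax ^ 2 + 32 * c ^ 2 * σ ^ 2 * α), by positivity, ?_⟩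
  intro K N A r μ Δmin hK hΔ hLM hgap a haα haσ hO hQ hinit Ω _ P _ ε hε φopt hopt T hT
  subst haα haσ
  refine ⟨EnvyBandit.Algorithm.integrable_cumulativeExcess hO hQ hε T, ?_⟩
  have hlog : 0 ≤ Real.log T := Real.log_natCast_nonneg T
  -- If every allocation is optimal, the gap condition is vacuous and `Δmin` may exceed `Δmax`, but
  -- then the regret is not positive. Otherwise a suboptimal allocation forces `Δmin ≤ Δmax`.
  by_cases hall : ∀ φ ∈ EnvyBandit.allocations A, φ ∈ EnvyBandit.minEnvyAllocations A r μ
  · refine le_trans (integral_nonpos fun ω => Finset.sum_nonpos fun t _ => ?_) (by positivity)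
    exact sub_nonpos.2 ((hall _ (EnvyBandit.Algorithm.allocation_mem _ hO hinit t)).2 _ hopt.1)
  · push Not at hall
    obtain ⟨φ, hφ, hφ'⟩ := hall
    have hle : Δmin ≤ Δmax :=
      (hgap.gap φ hφ hφ' φopt hopt).trans (hgap.envy_sub_le hK hΔmax.le hφ)
    have hN : 1 ≤ N := by
      by_contra! h
      obtain rfl : N = 0 := by omega
      exact hφ' (Subsingleton.elim φopt φ ▸ hopt)
    refine (EnvyBandit.Algorithm.integral_cumulativeExcess_le hLM hgap hK hc hΔ hΔmax.le hα hσ hO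
      hQ hinit hopt hε hT.le).trans ?_
    have hN' : (1 : ℝ) ≤ N := by exact_mod_cast hN
    have hlog2 : 1 / 2 ≤ Real.log T := by
      have h2 : (2 : ℝ) ≤ T := by exact_mod_cast (by omega : 2 ≤ T)
      have := Real.log_le_log (by norm_num) h2
      linarith [Real.log_two_gt_d9]
    -- Uses `N ≤ N ^ 3`, `1 ≤ 2 * log T` and `1 ≤ Δmax ^ 2 / Δmin ^ 2`.
    have hbase : (N : ℝ) ≤ 2 * Δmax ^ 2 * ((N : ℝ) ^ 3 * Real.log T / Δmin ^ 2) := by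
      have h1 : 1 ≤ Δmax ^ 2 / Δmin ^ 2 := by
        rw [one_le_div (by positivity)]
        gcongr
      have h2 : (N : ℝ) ≤ (N : ℝ) ^ 3 := le_self_pow₀ hN' (by norm_num)
      calc (N : ℝ) = N * 1 * 1 := by ring
        _ ≤ (N : ℝ) ^ 3 * (2 * Real.log T) * (Δmax ^ 2 / Δmin ^ 2) := by
            gcongr
            linarith
        _ = _ := by ring
    set B := (N : ℝ) ^ 3 * Real.log T / Δmin ^ 2
    calc _ = Δmax * ((2 + 2 * Z) * N + 32 * c ^ 2 * a.σ ^ 2 * a.α * B) := by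
          simp only [B, Z]; ring
      _ ≤ Δmax * ((2 + 2 * Z) * (2 * Δmax ^ 2 * B) + 32 * c ^ 2 * a.σ ^ 2 * a.α * B) := by
          gcongr
      _ = _ := by ring
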